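/- Let $a(x,y)=(x+1,y)$, $b(x,y)=(x,y+1)$, $c(x,y)=(-x,-y)$ and let $p2$ be the group of isometries of the Euclidean plane $\mathbb{R}^2$ generated by $a,b,c$ (products are compositions). For $A,B\in\mathbb{Z}$ with $2\le -A\le B$ and $2|A|<B+3$, let $$g(x,y)=\begin{pmatrix}0&-B\\1&-A\end{pmatrix}\begin{pmatrix}x\\y\end{pmatrix}+\begin{pmatrix}\frac{B-1}{2}\\0\end{pmatrix},\qquad \mathcal{D}=\{\mathrm{id},a,\dots,a^{B-2},c\}$$ (so $\mathcal{D}=\{\mathrm{id},c\}$ if $B=2$). Then there is a unique nonempty compact set $T\subset\mathbb{R}^2$ with $g(T)=\bigcup_{\delta\in\mathcal{D}}\delta(T)$, and its neighbor set $\mathcal{S}=\{\gamma\in p2\setminus\{\mathrm{id}\} : \gamma(T)\cap T\ne\emptyset\}$ is as follows. 1. If $A=-2$ and $B=2$, then $\mathcal{S}=\{a^{-1}b,\ ab^{-1},\ c,\ a^{-1}c,\ a^{-2}bc,\ a^{-1}bc\}$ (6 elements). 2. If $A=-2$ and $B=3$, then $\mathcal{S}=\{a,\ a^{-1},\ c,\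 a^{-1}c,\ a^{-2}bc,\ a^{-1}bc\}$ (6 elements). 3. If $A=-2$ and $B\ge 4$, then $\mathcal{S}=\{a,\ a^{-1},\ c,\ ac,\ a^{-2}bc,\ a^{-1}bc\}$ (6 elements). 4. If $A=-3$ and $B=4$, then $\mathcal{S}=\{a,\ a^{-1},\ a^{-2}b,\ a^{2}b^{-1},\ c,\ a^{-1}c,\ a^{-2}bc,\ a^{-3}bc\}$ (8 elements). 5. If $A=-3$ and $B\ge 5$, then $\mathcal{S}=\{a,\ a^{-1},\ a^{A+1}b,\ a^{-1-A}b^{-1},\ c,\ ac,\ a^{A+1}bc,\ a^{A}bc,\ a^{-1}c\}$ (9 elements). 6. If $A\le -4$ and $B\ge 6$, then $\mathcal{S}=\{a,\ a^{-1},\ a^{A+1}b,\ a^{-1-A}b^{-1},\ c,\ a^{-1}c,\ ac,\ a^{A+1}bc,\ a^{A}bc,\ a^{-A-1}b^{-1}c\}$ (10 elements). -/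

import Mathlib

namespace P2Tile

noncomputable section

/-- The Euclidean plane. -/
abbrev Plane : Type := EuclideanSpace ℝ (Fin 2)

/-- The translation `a (x, y) = (x + 1, y)`. -/
def a : Plane ≃ᵢ Plane := IsometryEquiv.addRight !₂[1, 0]

/-- The translation `b (x, y) = (x, y + 1)`. -/
def b : Plane ≃ᵢ Plane := IsometryEquiv.addRight !₂[0, 1]

/-- The rotation by the angle `π` about the origin, `c (x, y) = (-x, -y)`. -/
def c : Plane ≃ᵢ Plane := IsometryEquiv.neg Plane

/-- The standard crystallographic group `p2`: the group of isometries of the plane generated by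
`a`, `b` and `c`. The product of isometries is composition. -/
def p2 : Subgroup (Plane ≃ᵢ Plane) := Subgroup.closure {a, b, c}

/-- The linear part of the expanding map `g`. -/
def linPart (A B : ℤ) : Matrix (Fin 2) (Fin 2) ℝ := !![0, -(B : ℝ); 1, -(A : ℝ)]

/-- The expanding affine map `g v = M v + ((B - 1) / 2, 0)`, where `M = linPart A B`. -/
def g (A B : ℤ) (v : Plane) : Plane :=
  WithLp.toLp 2 ((linPart A B).mulVec v.ofLp + ![((B : ℝ) - 1) / 2, 0])

/-- The digit set `{id, a, …, a ^ (B - 2), c}`; for `B = 2` it is `{id, c}`. -/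
def digits (B : ℤ) : Set (Plane ≃ᵢ Plane) :=
  {δ | (∃ i : ℤ, 0 ≤ i ∧ i ≤ B - 2 ∧ δ = a ^ i) ∨ δ = c}

/-- `T` is a nonempty compact set with `g T = ⋃ δ ∈ digits, δ T`. -/
structure IsCrystile (A B : ℤ) (T : Set Plane) : Prop where
  isCompact : IsCompact T
  nonempty : T.Nonempty
  set_eq : g A B '' T = ⋃ δ ∈ digits B, δ '' T

/-- The neighbor set of `T` with respect to the group `p2`. -/
def neighborSet (T : Set Plane) : Set (Plane ≃ᵢ Plane) :=
  {γ | γ ∈ p2 ∧ γ ≠ 1 ∧ (γ '' T ∩ T).Nonempty}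

end

end P2Tile

open P2Tile

/-!
Let `M` be the linear part of `g`. The set equation says that `T` is the attractor of the maps
`g⁻¹ ∘ δ` with `δ` a digit. The map `M⁻¹` contracts the norm `‖L ·‖` for a suitable linear
automorphism `L` (`exists_adapted_norm`, an explicit Lyapunov form for the companion matrix of
`M⁻¹`), so existence and uniqueness of `T` are Hutchinson's theorem
(`existsUnique_compact_eq_iUnion_image`).

For the neighbors, if `T` meets `γ T`, then applying `g` to a common point gives digits `δ`, `δ'`
such that `T` meets `γ' T` with `γ' = δ⁻¹ g γ g⁻¹ δ'`. So neighbors and the identity are vertices of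
infinite walks with bounded vertices in the graph with these edges (`Meets.exists_step`).
Conversely, along an edge the distance between `γ T` and `T` in the norm `‖L ·‖` is at most `K < 1`
times the distance between `γ' T` and `T` (`IsCrystile.exists_norm_le`). Hence in a finite set of
vertices, each of which has an edge into the set, all these distances vanish
(`meets_of_mem_nbrStates`).

It remains to find the bounded infinite walks. Along a walk the second coordinate of the translation
vector is, up to signs, an integer sequence `N` with
`|N (k + 2) + A * N (k + 1) + B * N k| ≤ B - 1`. If its largest absolute value `K` were at least `2`, then `K` could only be followed by `K`, and
the constant sequence violates the bound because `B - 1 < 2 * (1 + A + B)`; this is the hypothesis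
`2 * |A| < B + 3` (`abs_le_one_of_recurrence`). So `N` takes values in `{-1, 0, 1}`. Taking `N k`
and `N (k + 1)` as coordinates leaves eighteen vertices, and repeatedly removing those without a
successor leaves the identity and the isometries in the list (`mem_nbrStates_of_invariant`), each of
which has a successor in the list (`exists_step_of_mem_nbrStates`).
-/

namespace P2Tile

/-! ### Iterated function systems -/

open TopologicalSpace Metric in
/-- Hutchinson's theorem: the map `K ↦ ⋃ i, f i '' K` is a contraction for the Hausdorff distance
on nonempty compact sets. -/
theorem existsUnique_compact_eq_iUnion_image {ι X : Type*} [Finite ι] [Nonempty ι] [MetricSpace X]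
    [CompleteSpace X] [Nonempty X] {K : NNReal} (hK : K < 1) (f : ι → X → X)
    (hf : ∀ i, LipschitzWith K (f i)) :
    ∃! T : Set X, IsCompact T ∧ T.Nonempty ∧ T = ⋃ i, f i '' T := by
  let F : NonemptyCompacts X → NonemptyCompacts X := fun S =>
    ⟨⟨⋃ i, f i '' S, isCompact_iUnion fun i => S.isCompact.image (hf i).continuous⟩,
      Set.nonempty_iUnion.2 ⟨Classical.arbitrary ι, S.nonempty.image _⟩⟩
  have hFc : ∀ S, (F S : Set X) = ⋃ i, f i '' S := fun _ => rfl
  have hF : ContractingWith K F := by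
    refine ⟨hK, fun S S' => ?_⟩
    change hausdorffEDist (F S : Set X) (F S') ≤ K * hausdorffEDist (S : Set X) S'
    rw [hFc, hFc]
    refine hausdorffEDist_iUnion_le.trans (iSup_le fun i => ?_)
    have key : ∀ U V : NonemptyCompacts X, ∀ x ∈ f i '' U,
        infEDist x (f i '' V) ≤ K * hausdorffEDist (U : Set X) V := by
      rintro U V _ ⟨x, hx, rfl⟩
      obtain ⟨y, hy, hxy⟩ := V.isCompact.exists_infEDist_eq_edist V.nonempty x
      calc infEDist (f i x) (f i '' V) ≤ edist (f i x) (f i y) :=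
            infEDist_le_edist_of_mem (Set.mem_image_of_mem _ hy)
        _ ≤ K * edist x y := hf i x y
        _ ≤ K * hausdorffEDist (U : Set X) V := by
            rw [← hxy]
            gcongr
            exact infEDist_le_hausdorffEDist_of_mem hx
    refine hausdorffEDist_le_of_infEDist (key _ _) ?_
    rw [hausdorffEDist_comm]
    exact key _ _
  have : Nonempty (NonemptyCompacts X) := ⟨{Classical.arbitrary X}⟩
  refine ⟨(hF.fixedPoint : NonemptyCompacts X), ⟨NonemptyCompacts.isCompact _,
    NonemptyCompacts.nonempty _, ?_⟩, ?_⟩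
  · rw [← hFc, hF.fixedPoint_isFixedPt]
  · rintro T ⟨hc, hn, hT⟩
    have := hF.fixedPoint_unique (x := ⟨⟨T, hc⟩, hn⟩) (by
      apply SetLike.coe_injective
      rw [hFc]
      exact hT.symm)
    exact congrArg (fun S : NonemptyCompacts X => (S : Set X)) this

/-! ### An adapted norm for the linear part -/

/-- A quadratic form that decreases under `(y, z) ↦ (t * y - d * z, y)`, the inverse of a companion
matrix, by a multiple of `y ^ 2 + z ^ 2`. The condition `t < 1 + d` is the Schur stability of
`X ^ 2 - t * X + d`. -/
theorem exists_lyapunov_coeffs {t d : ℝ} (ht : 0 < t) (hd : 0 < d) (hd1 : d < 1)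
    (htd : t < 1 + d) :
    ∃ β γ ε : ℝ, β ^ 2 < γ ∧ γ ≤ 1 ∧ 0 < ε ∧ ε < 1 ∧ ∀ y z : ℝ,
      y ^ 2 + 2 * β * y * z + γ * z ^ 2 -
        ((t * y - d * z) ^ 2 + 2 * β * (t * y - d * z) * y + γ * y ^ 2) = ε * (y ^ 2 + z ^ 2) := by
  -- `β` removes the mixed term, `γ` makes the coefficients of `y ^ 2` and `z ^ 2` equal.
  have h1 : 0 < 1 + d := by linarith
  set r := t / (1 + d) with hr
  have hr0 : 0 < r := by positivity
  have hr1 : r < 1 := by rw [hr, div_lt_one h1]; exact htd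
  have htr : t = r * (1 + d) := by rw [hr]; field_simp
  have hr2 : r ^ 2 < 1 := by nlinarith
  have hdd : d ^ 2 < 1 := by nlinarith
  refine ⟨-(r * d), (d ^ 2 + 1 - r ^ 2 * (1 - d ^ 2)) / 2, (1 - d ^ 2) * (1 - r ^ 2) / 2,
    ?_, ?_, ?_, ?_, ?_⟩
  · nlinarith [mul_pos (sub_pos.2 hr2) (sub_pos.2 hdd), mul_pos (sub_pos.2 hr2) (pow_pos hd 2)]
  · nlinarith [mul_pos (pow_pos hr0 2) (sub_pos.2 hdd)]
  · have := mul_pos (sub_pos.2 hdd) (sub_pos.2 hr2); linarith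
  · nlinarith [mul_pos (pow_pos hr0 2) (sub_pos.2 hdd), pow_pos hd 2]
  · intro y z
    rw [htr]
    ring

/-- The linear part of `g` as a function on the plane. -/
def linMap (A B : ℤ) (v : Plane) : Plane := !₂[-(B : ℝ) * v 1, v 0 - A * v 1]

/-- The inverse of the linear part of `g` contracts the norm `‖L ·‖` for a suitable linear
automorphism `L` of the plane. -/
theorem exists_adapted_norm {A B : ℤ} (hA : 2 ≤ -A) (hAB : -A ≤ B) :
    ∃ (L : Plane ≃L[ℝ] Plane) (K : NNReal), K < 1 ∧ ∀ v, ‖L v‖ ≤ K * ‖L (linMap A B v)‖ := by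
  have hB : (2 : ℝ) ≤ B := by exact_mod_cast hA.trans hAB
  have hA' : (2 : ℝ) ≤ -A := by exact_mod_cast hA
  have hAB' : -(A : ℝ) ≤ B := by exact_mod_cast hAB
  obtain ⟨β, γ, ε, hβ, hγ, hε, hε1, hQ⟩ := exists_lyapunov_coeffs (t := -A / B) (d := 1 / B)
    (by apply div_pos <;> linarith) (by positivity) (by rw [div_lt_one] <;> linarith)
    (by rw [div_lt_iff₀ (by linarith)]; field_simp; linarith)
  set κ := Real.sqrt (γ - β ^ 2) with hκ
  have hκ2 : κ ^ 2 = γ - β ^ 2 := Real.sq_sqrt (by linarith)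
  have hκ0 : κ ≠ 0 := (Real.sqrt_pos.2 (by linarith)).ne'
  -- `‖L v‖ ^ 2 = x ^ 2 + 2 β x y + γ y ^ 2` where `x` and `y` are the second coordinates of `v`
  -- and of its image under the linear part.
  let L₀ : Plane ≃ₗ[ℝ] Plane :=
    { toFun := fun v => !₂[v 1 + β * (v 0 - A * v 1), κ * (v 0 - A * v 1)]
      map_add' := by intro u v; ext i; fin_cases i <;> simp <;> ring
      map_smul' := by intro r v; ext i; fin_cases i <;> simp <;> ring
      invFun := fun w => !₂[w 1 / κ + A * (w 0 - β * (w 1 / κ)), w 0 - β * (w 1 / κ)]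
      left_inv := by intro v; ext i; fin_cases i <;> simp <;> field_simp <;> ring
      right_inv := by intro v; ext i; fin_cases i <;> simp; field_simp }
  have hL : ∀ v, ‖L₀ v‖ ^ 2 = (v 1) ^ 2 + 2 * β * v 1 * (v 0 - A * v 1)
      + γ * (v 0 - A * v 1) ^ 2 := by
    intro v
    rw [EuclideanSpace.norm_sq_eq, Fin.sum_univ_two]
    simp only [L₀, LinearEquiv.coe_mk, LinearMap.coe_mk, AddHom.coe_mk, Real.norm_eq_abs, sq_abs]
    simp
    have : γ = κ ^ 2 + β ^ 2 := by linarith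
    rw [this]; ring
  refine ⟨L₀.toContinuousLinearEquiv, Real.toNNReal (Real.sqrt (1 - ε / 2)), ?_, ?_⟩
  · rw [Real.toNNReal_lt_one]
    exact (Real.sqrt_lt' one_pos).2 (by linarith)
  · intro v
    rw [Real.coe_toNNReal _ (Real.sqrt_nonneg _)]
    change ‖L₀ v‖ ≤ Real.sqrt (1 - ε / 2) * ‖L₀ (linMap A B v)‖
    refine (sq_le_sq₀ (by positivity) (by positivity)).1 ?_
    rw [mul_pow, Real.sq_sqrt (by linarith), hL, hL]
    have h := hQ (v 0 - A * v 1) (-(B : ℝ) * v 1 - A * (v 0 - A * v 1))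
    have hx : -(A : ℝ) / B * (v 0 - A * v 1) - 1 / B * (-(B : ℝ) * v 1 - A * (v 0 - A * v 1))
        = v 1 := by field_simp; ring
    rw [hx] at h
    simp only [linMap]
    simp
    simp at h
    generalize v 0 - A * v 1 = y at *
    generalize -((B : ℝ) * v 1) - A * y = z at *
    have h2 : y ^ 2 + 2 * β * y * z + γ * z ^ 2 ≤ 2 * (y ^ 2 + z ^ 2) := by
      nlinarith [sq_nonneg (y - β * z), mul_nonneg (sub_nonneg.2 hγ) (sq_nonneg z),
        mul_nonneg (sub_nonneg.2 hβ.le) (sq_nonneg z)]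
    nlinarith

/-! ### The neighbor graph -/

/-- The pair `(s, i)` is the digit `v ↦ s • v + (i, 0)`. -/
def IsDigit (B s i : ℤ) : Prop := (s = 1 ∧ 0 ≤ i ∧ i ≤ B - 2) ∨ (s = -1 ∧ i = 0)

/-- An edge of the neighbor graph. A triple `(e, x, y)` stands for the isometry
`v ↦ e • v + (y + A * x, x)` with `e = 1` or `e = -1`; the second component of the image of
`(y + A * x, x)` under the linear part of `g` is `y`. There is an edge from `γ` to `γ'` if
`g ∘ γ = δ ∘ γ' ∘ δ'⁻¹ ∘ g` for some digits `δ = (s, i)` and `δ' = (s', j)`. -/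
def Step (A B e x y e' x' y' : ℤ) : Prop :=
  ∃ s i s' j, IsDigit B s i ∧ IsDigit B s' j ∧ e' = s * e * s' ∧ x' = s * y ∧
    2 * (s * y' + A * y + B * x) = 2 * (e * j - i) + (1 - e) * (B - 1)

/-- The solutions of the recurrence underlying the neighbor graph that stay bounded only take the
values `-1`, `0` and `1`. -/
theorem abs_le_one_of_recurrence {A B : ℤ} (hA : 2 ≤ -A) (hAB : -A ≤ B) (h : 2 * -A < B + 3)
    (R : ℤ → ℤ → Prop) (C : ℤ) (hC : ∀ x y, R x y → |x| ≤ C)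
    (hneg : ∀ x y, R x y → R (-x) (-y))
    (hR : ∀ x y, R x y → ∃ z, |z + A * y + B * x| ≤ B - 1 ∧ R y z) :
    ∀ x y, R x y → |x| ≤ 1 := by
  intro x₀ y₀ h₀
  -- `K` is the largest value attained.
  obtain ⟨K, ⟨y, hKy⟩, hmax⟩ := Int.exists_greatest_of_bdd (P := fun x => ∃ y, R x y)
    ⟨C, fun x ⟨y, hxy⟩ => (le_abs_self x).trans (hC x y hxy)⟩ ⟨x₀, y₀, h₀⟩
  have hbd : ∀ x y, R x y → -K ≤ x ∧ x ≤ K := fun x y hxy =>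
    ⟨by have := hmax (-x) ⟨_, hneg _ _ hxy⟩; omega, hmax x ⟨y, hxy⟩⟩
  suffices hK : K ≤ 1 by
    have := hbd _ _ h₀
    rw [abs_le]; omega
  by_contra! hK
  obtain ⟨α, rfl⟩ : ∃ α, A = -α := ⟨-A, by ring⟩
  -- The largest value is followed by itself.
  have hnext : ∀ y, R K y → y = K := by
    intro y hy
    obtain ⟨z, hz, hyz⟩ := hR _ _ hy
    obtain ⟨w, hw, hzw⟩ := hR _ _ hyz
    obtain ⟨u, -, hwu⟩ := hR _ _ hzw
    have h1 := hbd _ _ hyz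
    have h2 := hbd _ _ hzw
    have h3 := hbd _ _ hwu
    rw [abs_le] at hz hw
    by_contra hne
    have hlt : y ≤ K - 1 := by omega
    -- For `α + 1 < B` the first recurrence relation suffices; only three pairs remain otherwise.
    rcases lt_or_ge (α + 1) B with hB | hB
    · nlinarith
    · have : α = 2 ∧ B = 2 ∨ α = 2 ∧ B = 3 ∨ α = 3 ∧ B = 4 := by omega
      rcases this with ⟨rfl, rfl⟩ | ⟨rfl, rfl⟩ | ⟨rfl, rfl⟩ <;> omega
  obtain rfl := hnext y hKy
  obtain ⟨z, hz, hyz⟩ := hR _ _ hKy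
  obtain rfl := hnext z hyz
  rw [abs_le] at hz
  nlinarith

/-- The vertices of the infinite walks with bounded vertices in the neighbor graph, given by the
conditions on `A` and `B` under which each of them occurs. The state `(1, 0, 0)` is the identity. -/
def nbrStates (A B : ℤ) : Set (ℤ × ℤ × ℤ) :=
  {p | p = (1, 0, 0) ∨ p = (-1, 0, 0) ∨ p = (-1, 1, 1) ∨ p = (-1, 1, 0) ∨
    (B ≠ 2 ∧ (p = (1, 0, 1) ∨ p = (1, 0, -1))) ∨
    ((B = 2 ∨ A ≠ -2) ∧ (p = (1, 1, 1) ∨ p = (1, -1, -1))) ∨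
    ((B ≤ 3 ∨ A ≠ -2) ∧ p = (-1, 0, -1)) ∨
    (2 ≤ B + A ∧ p = (-1, 0, 1)) ∨
    (A ≤ -4 ∧ p = (-1, -1, -1))}

/-- `P` is a set of states with bounded second component, each having an edge into the set. -/
theorem abs_le_one_of_invariant {A B : ℤ} (hA : 2 ≤ -A) (hAB : -A ≤ B) (h : 2 * -A < B + 3)
    (P : ℤ → ℤ → ℤ → Prop) (C : ℤ) (hC : ∀ e x y, P e x y → (e = 1 ∨ e = -1) ∧ |x| ≤ C)
    (hP : ∀ e x y, P e x y → ∃ e' x' y', Step A B e x y e' x' y' ∧ P e' x' y')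
    (e x y : ℤ) (hexy : P e x y) : |x| ≤ 1 := by
  refine abs_le_one_of_recurrence hA hAB h (fun x y => ∃ e, P e x y ∨ P e (-x) (-y)) C
    ?_ ?_ ?_ x y ⟨e, Or.inl hexy⟩
  · rintro x y ⟨e, he | he⟩
    · exact (hC _ _ _ he).2
    · simpa using (hC _ _ _ he).2
  · rintro x y ⟨e, he | he⟩
    · exact ⟨e, Or.inr (by simpa using he)⟩
    · exact ⟨e, Or.inl he⟩
  · have key : ∀ e x y, P e x y → ∃ z, |z + A * y + B * x| ≤ B - 1 ∧
        ∃ e, P e y z ∨ P e (-y) (-z) := by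
      intro e x y he
      obtain ⟨e', x', y', ⟨s, i, s', j, hs, hs', -, rfl, hD⟩, hP'⟩ := hP _ _ _ he
      refine ⟨s * y', ?_, e', ?_⟩
      · rcases (hC _ _ _ he).1 with rfl | rfl <;> rcases hs with ⟨rfl, hs⟩ | ⟨rfl, hs⟩ <;>
          rcases hs' with ⟨rfl, hs'⟩ | ⟨rfl, hs'⟩ <;> rw [abs_le] <;> constructor <;> linarith
      · rcases hs with ⟨rfl, -⟩ | ⟨rfl, -⟩
        · exact Or.inl (by simpa using hP')
        · exact Or.inr (by simpa using hP')
    rintro x y ⟨e, he | he⟩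
    · exact key _ _ _ he
    · obtain ⟨z, hz, e', he'⟩ := key _ _ _ he
      refine ⟨-z, ?_, e', ?_⟩
      · rw [← abs_neg]; convert hz using 2; ring
      · rw [neg_neg] at he' ⊢; exact he'.symm

/-- In terms of `e`, `x`, `y` and the next value `z` there are six kinds of edges between states
with bounded walks. -/
theorem edge_cases_of_invariant {A B : ℤ} (hA : 2 ≤ -A) (hAB : -A ≤ B) (h : 2 * -A < B + 3)
    (P : ℤ → ℤ → ℤ → Prop) (C : ℤ) (hC : ∀ e x y, P e x y → (e = 1 ∨ e = -1) ∧ |x| ≤ C)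
    (hP : ∀ e x y, P e x y → ∃ e' x' y', Step A B e x y e' x' y' ∧ P e' x' y') :
    ∀ e x y, P e x y → ∃ z, (-1 ≤ z ∧ z ≤ 1) ∧
      ((e = 1 ∧ (P 1 y z ∨ P 1 (-y) (-z)) ∧ |z + A * y + B * x| ≤ B - 2) ∨
      (e = 1 ∧ P (-1) y z ∧ -(B - 2) ≤ z + A * y + B * x ∧ z + A * y + B * x ≤ 0) ∨
      (e = 1 ∧ P (-1) (-y) (-z) ∧ 0 ≤ z + A * y + B * x ∧ z + A * y + B * x ≤ B - 2) ∨
      (e = -1 ∧ P (-1) y z ∧ -(B - 3) ≤ z + A * y + B * x ∧ z + A * y + B * x ≤ B - 1) ∨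
      (e = -1 ∧ (P 1 y z ∨ P 1 (-y) (-z)) ∧ 1 ≤ z + A * y + B * x ∧ z + A * y + B * x ≤ B - 1) ∨
      (e = -1 ∧ P (-1) (-y) (-z) ∧ z + A * y + B * x = B - 1)) := by
  have hx := abs_le_one_of_invariant hA hAB h P C hC hP
  intro e x y he
  obtain ⟨e', x', y', ⟨s, i, s', j, hs, hs', rfl, rfl, hD⟩, hP'⟩ := hP _ _ _ he
  have hy' : |y'| ≤ 1 := by
    obtain ⟨e'', x'', y'', ⟨s, i, s', j, hs, -, -, rfl, -⟩, hP''⟩ := hP _ _ _ hP'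
    have := hx _ _ _ hP''
    rcases hs with ⟨rfl, -⟩ | ⟨rfl, -⟩ <;> simpa using this
  rw [abs_le] at hy'
  refine ⟨s * y', ?_, ?_⟩
  · rcases hs with ⟨rfl, -⟩ | ⟨rfl, -⟩ <;> omega
  · rw [abs_le]
    rcases (hC _ _ _ he).1 with rfl | rfl <;> rcases hs with ⟨rfl, hs⟩ | ⟨rfl, hs⟩ <;>
      rcases hs' with ⟨rfl, hs'⟩ | ⟨rfl, hs'⟩ <;> simp at hP' hD ⊢ <;>
      simp only [hP', true_or, or_true, true_and] <;> omega

/-- Every walk with bounded states stays in `nbrStates A B`. -/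
theorem mem_nbrStates_of_invariant {A B : ℤ} (hA : 2 ≤ -A) (hAB : -A ≤ B) (h : 2 * -A < B + 3)
    (P : ℤ → ℤ → ℤ → Prop) (C : ℤ) (hC : ∀ e x y, P e x y → (e = 1 ∨ e = -1) ∧ |x| ≤ C)
    (hP : ∀ e x y, P e x y → ∃ e' x' y', Step A B e x y e' x' y' ∧ P e' x' y')
    (e x y : ℤ) (hp : P e x y) : (e, x, y) ∈ nbrStates A B := by
  have hx := abs_le_one_of_invariant hA hAB h P C hC hP
  have key := edge_cases_of_invariant hA hAB h P C hC hP
  -- States without a successor whose entries lie in `{-1, 0, 1}`.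
  have d1 : ∀ e, ¬ P e 1 (-1) := by
    intro e he
    obtain ⟨z, hz, H⟩ := key _ _ _ he
    rw [abs_le] at H
    omega
  have d2 : ∀ e, ¬ P e (-1) 1 := by
    intro e he
    obtain ⟨z, hz, H⟩ := key _ _ _ he
    rw [abs_le] at H
    omega
  have d3 : ¬ P (-1) (-1) 0 := by
    intro he
    obtain ⟨z, hz, H⟩ := key _ _ _ he
    rw [abs_le] at H
    omega
  have d4 : ¬ P 1 1 0 := by
    intro he
    obtain ⟨z, hz, H⟩ := key _ _ _ he
    rw [abs_le] at H
    omega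
  have d5 : ¬ P 1 (-1) 0 := by
    intro he
    obtain ⟨z, hz, H⟩ := key _ _ _ he
    rw [abs_le] at H
    omega
  -- States that only survive for some `A` and `B`; all their other successors are excluded above.
  have split : ∀ z : ℤ, (-1 ≤ z ∧ z ≤ 1) → z = -1 ∨ z = 0 ∨ z = 1 := by omega
  have d6 : P (-1) (-1) (-1) → A ≤ -4 := by
    intro he
    obtain ⟨z, hz, H⟩ := key _ _ _ he
    rw [abs_le] at H
    by_contra hA4
    rcases split z hz with rfl | rfl | rfl
    · omega
    · simp [d3, d4, d5] at H; omega
    · simp [d1, d2] at H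
  have d7 : ∀ u, u = 1 ∨ u = -1 → P 1 u u → B = 2 ∨ A ≠ -2 := by
    intro u hu he
    obtain ⟨z, hz, H⟩ := key _ _ _ he
    rw [abs_le] at H
    by_contra hA4
    rcases hu with rfl | rfl <;> rcases split z hz with rfl | rfl | rfl <;>
      simp [d1, d2, d3, d4, d5] at H <;> omega
  have d8 : ∀ u, u = 1 ∨ u = -1 → P 1 0 u → B ≠ 2 := by
    intro u hu he
    obtain ⟨z, hz, H⟩ := key _ _ _ he
    rw [abs_le] at H
    rcases hu with rfl | rfl <;> omega
  have d9 : P (-1) 0 1 → 2 ≤ B + A := by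
    intro he
    obtain ⟨z, hz, H⟩ := key _ _ _ he
    rw [abs_le] at H
    omega
  have d10 : P (-1) 0 (-1) → B ≤ 3 ∨ A ≠ -2 := by
    intro he
    obtain ⟨z, hz, H⟩ := key _ _ _ he
    rw [abs_le] at H
    by_contra hA4
    have h6 : ¬ P (-1) (-1) (-1) := fun h => by have := d6 h; omega
    have h7 : ¬ P 1 (-1) (-1) := fun h => by have := d7 _ (Or.inr rfl) h; omega
    have h7' : ¬ P 1 1 1 := fun h => by have := d7 _ (Or.inl rfl) h; omega
    rcases split z hz with rfl | rfl | rfl <;> simp [d1, d2, d3, d4, d5, h6, h7, h7'] at H <;> omega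
  have hx0 := hx _ _ _ hp
  have hy0 : |y| ≤ 1 := by
    obtain ⟨z, hz, H⟩ := key _ _ _ hp
    rcases H with H | H | H | H | H | H
    · rcases H.2.1 with H | H <;> simpa using hx _ _ _ H
    · simpa using hx _ _ _ H.2.1
    · simpa using hx _ _ _ H.2.1
    · simpa using hx _ _ _ H.2.1
    · rcases H.2.1 with H | H <;> simpa using hx _ _ _ H
    · simpa using hx _ _ _ H.2.1
  have he := (hC _ _ _ hp).1
  rw [abs_le] at hx0 hy0
  simp only [nbrStates, Set.mem_ofPred_eq, Prod.mk.injEq]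
  rcases he with rfl | rfl <;> rcases split x hx0 with rfl | rfl | rfl <;>
    rcases split y hy0 with rfl | rfl | rfl <;> norm_num <;>
    first
      | exact d1 _ hp | exact d2 _ hp | exact d3 hp | exact d4 hp | exact d5 hp
      | exact d6 hp | exact d9 hp | exact d10 hp
      | exact d7 _ (Or.inl rfl) hp | exact d7 _ (Or.inr rfl) hp
      | exact d8 _ (Or.inl rfl) hp | exact d8 _ (Or.inr rfl) hp

/-- Every state in `nbrStates A B` has an edge to a state in `nbrStates A B`. -/
theorem exists_step_of_mem_nbrStates {A B : ℤ} (hA : 2 ≤ -A) (hAB : -A ≤ B)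
    (h : 2 * -A < B + 3) {e x y : ℤ} (hp : (e, x, y) ∈ nbrStates A B) :
    ∃ e' x' y', Step A B e x y e' x' y' ∧ (e', x', y') ∈ nbrStates A B := by
  have mk : ∀ s i s' j y', IsDigit B s i → IsDigit B s' j → (s * e * s', s * y, y') ∈ nbrStates A B →
      2 * (s * y' + A * y + B * x) = 2 * (e * j - i) + (1 - e) * (B - 1) →
      ∃ e' x' y', Step A B e x y e' x' y' ∧ (e', x', y') ∈ nbrStates A B :=
    fun s i s' j y' hs hs' hm hD => ⟨_, _, y', ⟨s, i, s', j, hs, hs', rfl, rfl, hD⟩, hm⟩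
  simp only [nbrStates, Set.mem_ofPred_eq, Prod.mk.injEq] at hp mk ⊢
  unfold IsDigit at mk
  rcases hp with ⟨rfl, rfl, rfl⟩ | ⟨rfl, rfl, rfl⟩ | ⟨rfl, rfl, rfl⟩ | ⟨rfl, rfl, rfl⟩ |
    ⟨hB, ⟨rfl, rfl, rfl⟩ | ⟨rfl, rfl, rfl⟩⟩ | ⟨hB, ⟨rfl, rfl, rfl⟩ | ⟨rfl, rfl, rfl⟩⟩ |
    ⟨hB, rfl, rfl, rfl⟩ | ⟨hB, rfl, rfl, rfl⟩ | ⟨hB, rfl, rfl, rfl⟩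
  · refine mk 1 0 1 0 0 ?_ ?_ ?_ ?_ <;> norm_num <;> omega
  · rcases eq_or_ne B 2 with rfl | hB
    · refine mk (-1) 0 (-1) 0 (-1) ?_ ?_ ?_ ?_ <;> norm_num
    · refine mk 1 (B - 2) 1 1 0 ?_ ?_ ?_ ?_ <;> norm_num <;> omega
  · rcases eq_or_ne B 2 with rfl | hB
    · refine mk 1 0 1 0 1 ?_ ?_ ?_ ?_ <;> norm_num <;> omega
    · refine mk 1 (-A - 1) 1 0 0 ?_ ?_ ?_ ?_ <;> norm_num <;> omega
  · rcases eq_or_ne B 2 with rfl | hB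
    · refine mk 1 0 1 0 (-1) ?_ ?_ ?_ ?_ <;> norm_num
    · refine mk 1 0 (-1) 0 (-1) ?_ ?_ ?_ ?_ <;> norm_num <;> omega
  · refine mk 1 (-A - 1) (-1) 0 1 ?_ ?_ ?_ ?_ <;> norm_num <;> omega
  · refine mk (-1) 0 1 (-A - 1) 1 ?_ ?_ ?_ ?_ <;> norm_num <;> omega
  · rcases eq_or_ne B 2 with rfl | hB
    · refine mk 1 0 (-1) 0 0 ?_ ?_ ?_ ?_ <;> norm_num <;> omega
    · refine mk 1 0 1 (B + 1 + A) 1 ?_ ?_ ?_ ?_ <;> norm_num <;> omega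
  · rcases eq_or_ne B 2 with rfl | hB
    · refine mk (-1) 0 1 0 0 ?_ ?_ ?_ ?_ <;> norm_num <;> omega
    · refine mk 1 (B + 1 + A) 1 0 (-1) ?_ ?_ ?_ ?_ <;> norm_num <;> omega
  · rcases eq_or_ne A (-2) with rfl | hA2
    · obtain rfl | rfl : B = 2 ∨ B = 3 := by omega
      · refine mk (-1) 0 (-1) 0 1 ?_ ?_ ?_ ?_ <;> norm_num
      · refine mk (-1) 0 (-1) 0 0 ?_ ?_ ?_ ?_ <;> norm_num
    · refine mk 1 (B + A) (-1) 0 (-1) ?_ ?_ ?_ ?_ <;> norm_num <;> omega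
  · refine mk 1 (B - 2) 1 (-A) 1 ?_ ?_ ?_ ?_ <;> norm_num <;> omega
  · refine mk 1 (B - 2) 1 (B + 2 + A) (-1) ?_ ?_ ?_ ?_ <;> norm_num <;> omega

theorem finite_nbrStates (A B : ℤ) : (nbrStates A B).Finite := by
  refine ((Set.finite_Icc (-1 : ℤ) 1).prod
    ((Set.finite_Icc (-1 : ℤ) 1).prod (Set.finite_Icc (-1 : ℤ) 1))).subset ?_
  rintro ⟨e, x, y⟩ hp
  simp only [nbrStates, Set.mem_ofPred_eq, Prod.mk.injEq] at hp
  simp only [Set.mem_prod, Set.mem_Icc]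
  omega

/-! ### The tile -/

theorem g_zero (A B : ℤ) (v : Plane) : g A B v 0 = -(B : ℝ) * v 1 + ((B : ℝ) - 1) / 2 := by
  simp [g, linPart, dotProduct, Fin.sum_univ_two]

theorem g_one (A B : ℤ) (v : Plane) : g A B v 1 = v 0 - A * v 1 := by
  simp [g, linPart, dotProduct, Fin.sum_univ_two]
  ring

theorem a_zpow_apply (k : ℤ) (v : Plane) : (a ^ k) v = !₂[v 0 + k, v 1] := by
  have ha : ∀ v, a v = !₂[v 0 + 1, v 1] := by
    intro v; ext i; fin_cases i <;> simp [a]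
  have ha' : ∀ v, a⁻¹ v = !₂[v 0 - 1, v 1] := by
    intro v
    change a.symm v = _
    rw [IsometryEquiv.symm_apply_eq, ha]
    ext i; fin_cases i <;> simp
  induction k generalizing v with
  | zero => ext i; fin_cases i <;> simp
  | succ k ih =>
    rw [zpow_add_one, IsometryEquiv.mul_apply, ha, ih]
    ext i; fin_cases i <;> simp; ring
  | pred k ih =>
    rw [zpow_sub_one, IsometryEquiv.mul_apply, ha', ih]
    ext i; fin_cases i <;> simp; ring

theorem b_zpow_apply (k : ℤ) (v : Plane) : (b ^ k) v = !₂[v 0, v 1 + k] := by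
  have hb : ∀ v, b v = !₂[v 0, v 1 + 1] := by
    intro v; ext i; fin_cases i <;> simp [b]
  have hb' : ∀ v, b⁻¹ v = !₂[v 0, v 1 - 1] := by
    intro v
    change b.symm v = _
    rw [IsometryEquiv.symm_apply_eq, hb]
    ext i; fin_cases i <;> simp
  induction k generalizing v with
  | zero => ext i; fin_cases i <;> simp
  | succ k ih =>
    rw [zpow_add_one, IsometryEquiv.mul_apply, hb, ih]
    ext i; fin_cases i <;> simp; ring
  | pred k ih =>
    rw [zpow_sub_one, IsometryEquiv.mul_apply, hb', ih]
    ext i; fin_cases i <;> simp; ring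

theorem c_apply (v : Plane) : c v = !₂[-v 0, -v 1] := by
  ext i; fin_cases i <;> simp [c]

/-- The map `v ↦ e • v + (m, n)`. -/
noncomputable def affMap (e m n : ℤ) (v : Plane) : Plane := !₂[e * v 0 + m, e * v 1 + n]

theorem mem_digits_iff {B : ℤ} {δ : Plane ≃ᵢ Plane} :
    δ ∈ digits B ↔ ∃ s i, IsDigit B s i ∧ ⇑δ = affMap s i 0 := by
  have ha : ∀ i : ℤ, ⇑(a ^ i) = affMap 1 i 0 := by
    intro i; funext v; rw [a_zpow_apply]; ext k; fin_cases k <;> simp [affMap]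
  have hc : ⇑c = affMap (-1) 0 0 := by
    funext v; rw [c_apply]; ext k; fin_cases k <;> simp [affMap]
  constructor
  · rintro (⟨i, h0, h1, rfl⟩ | rfl)
    · exact ⟨1, i, Or.inl ⟨rfl, h0, h1⟩, ha i⟩
    · exact ⟨-1, 0, Or.inr ⟨rfl, rfl⟩, hc⟩
  · rintro ⟨s, i, ⟨rfl, h0, h1⟩ | ⟨rfl, rfl⟩, hδ⟩
    · exact Or.inl ⟨i, h0, h1, DFunLike.coe_injective (hδ.trans (ha i).symm)⟩
    · exact Or.inr (DFunLike.coe_injective (hδ.trans hc.symm))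

theorem iUnion_digits (B : ℤ) (T : Set Plane) :
    ⋃ δ ∈ digits B, δ '' T = ⋃ p : {p : ℤ × ℤ // IsDigit B p.1 p.2}, affMap p.1.1 p.1.2 0 '' T := by
  have hex : ∀ s i, IsDigit B s i → ∃ δ : Plane ≃ᵢ Plane, ⇑δ = affMap s i 0 := by
    rintro s i (⟨rfl, -⟩ | ⟨rfl, rfl⟩)
    · refine ⟨a ^ i, ?_⟩
      funext v; rw [a_zpow_apply]; ext k; fin_cases k <;> simp [affMap]
    · refine ⟨c, ?_⟩
      funext v; rw [c_apply]; ext k; fin_cases k <;> simp [affMap]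
  ext x
  simp only [Set.mem_iUnion]
  constructor
  · rintro ⟨δ, hδ, hx⟩
    obtain ⟨s, i, hs, h⟩ := mem_digits_iff.1 hδ
    exact ⟨⟨(s, i), hs⟩, by rwa [h] at hx⟩
  · rintro ⟨⟨⟨s, i⟩, hs⟩, hx⟩
    obtain ⟨δ, h⟩ := hex s i hs
    exact ⟨δ, mem_digits_iff.2 ⟨s, i, hs, h⟩, by rwa [h]⟩

theorem finite_isDigit (B : ℤ) : Finite {p : ℤ × ℤ // IsDigit B p.1 p.2} := by
  refine Set.Finite.to_subtype (((Set.finite_Icc (-1 : ℤ) 1).prod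
    (Set.finite_Icc (0 : ℤ) (max 0 (B - 2)))).subset ?_)
  rintro ⟨s, i⟩ hp
  change IsDigit B s i at hp
  unfold IsDigit at hp
  simp only [Set.mem_prod, Set.mem_Icc]
  omega

/-- The inverse of `g A B`. -/
noncomputable def gInv (A B : ℤ) (w : Plane) : Plane :=
  !₂[w 1 - A * ((w 0 - ((B : ℝ) - 1) / 2) / B), -((w 0 - ((B : ℝ) - 1) / 2) / B)]

theorem gInv_g {A B : ℤ} (hB : 2 ≤ B) (v : Plane) : gInv A B (g A B v) = v := by
  have : (B : ℝ) ≠ 0 := by norm_cast; omega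
  ext i; fin_cases i <;> simp [gInv, g_zero, g_one] <;> field_simp <;> ring

theorem g_gInv {A B : ℤ} (hB : 2 ≤ B) (v : Plane) : g A B (gInv A B v) = v := by
  have : (B : ℝ) ≠ 0 := by norm_cast; omega
  ext i; fin_cases i
  · change g A B _ 0 = v 0
    rw [g_zero]; simp [gInv]; field_simp; ring
  · change g A B _ 1 = v 1
    rw [g_one]; simp [gInv]

theorem linMap_gInv_sub {A B : ℤ} (hB : 2 ≤ B) (v w : Plane) :
    linMap A B (gInv A B v - gInv A B w) = v - w := by
  have : (B : ℝ) ≠ 0 := by norm_cast; omega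
  ext i; fin_cases i <;> simp [gInv, linMap] <;> field_simp <;> ring

theorem affMap_sub {e : ℤ} (m n : ℤ) (v w : Plane) :
    affMap e m n v - affMap e m n w = (e : ℝ) • (v - w) := by
  ext i; fin_cases i <;> simp [affMap] <;> ring

theorem IsDigit.abs_eq_one {B s i : ℤ} (h : IsDigit B s i) : |(s : ℝ)| = 1 := by
  rcases h with ⟨rfl, -⟩ | ⟨rfl, -⟩ <;> simp

/-- The linear automorphism `L` turns the tile equation into the equation of an iterated function
system of contractions. -/
theorem existsUnique_isCrystile {A B : ℤ} (hA : 2 ≤ -A) (hAB : -A ≤ B) :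
    ∃! T : Set Plane, IsCrystile A B T := by
  have hB : 2 ≤ B := hA.trans hAB
  obtain ⟨L, K, hK, hL⟩ := exists_adapted_norm hA hAB
  have := finite_isDigit B
  have : Nonempty {p : ℤ × ℤ // IsDigit B p.1 p.2} := ⟨⟨(-1, 0), Or.inr ⟨rfl, rfl⟩⟩⟩
  let f : {p : ℤ × ℤ // IsDigit B p.1 p.2} → Plane → Plane := fun p w =>
    L (gInv A B (affMap p.1.1 p.1.2 0 (L.symm w)))
  have hf : ∀ p, LipschitzWith K (f p) := by
    intro p
    refine LipschitzWith.of_dist_le_mul fun v w => ?_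
    simp only [f]
    rw [dist_eq_norm, ← map_sub]
    refine (hL _).trans (le_of_eq ?_)
    rw [linMap_gInv_sub hB, affMap_sub, map_smul, norm_smul, Real.norm_eq_abs,
      p.2.abs_eq_one, one_mul, map_sub, L.apply_symm_apply, L.apply_symm_apply, dist_eq_norm]
  have hiff : ∀ T : Set Plane, IsCrystile A B T ↔
      IsCompact (L '' T) ∧ (L '' T).Nonempty ∧ L '' T = ⋃ p, f p '' (L '' T) := by
    intro T
    have h1 : ⋃ p, f p '' (L '' T) = L '' (gInv A B '' ⋃ δ ∈ digits B, δ '' T) := by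
      rw [iUnion_digits, Set.image_iUnion, Set.image_iUnion]
      refine Set.iUnion_congr fun p => ?_
      simp only [Set.image_image, f, L.symm_apply_apply]
    have h2 : L '' T = L '' (gInv A B '' ⋃ δ ∈ digits B, δ '' T) ↔
        g A B '' T = ⋃ δ ∈ digits B, δ '' T := by
      rw [L.injective.image_injective.eq_iff]
      constructor
      · intro h
        nth_rw 1 [h]
        rw [Set.image_image]
        simp [g_gInv hB]
      · intro h
        rw [← h, Set.image_image]
        simp [gInv_g hB]
    rw [h1, h2, Set.image_nonempty]
    have h3 : IsCompact (L '' T) ↔ IsCompact T := L.toHomeomorph.isCompact_image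
    rw [h3]
    exact ⟨fun ⟨x, y, z⟩ => ⟨x, y, z⟩, fun ⟨x, y, z⟩ => ⟨x, y, z⟩⟩
  obtain ⟨S, hS, huniq⟩ := existsUnique_compact_eq_iUnion_image hK f hf
  have hLS : L '' (L.symm '' S) = S := by simp [Set.image_image]
  refine ⟨L.symm '' S, (hiff _).2 (by rw [hLS]; exact hS), fun T hT => ?_⟩
  rw [← huniq _ ((hiff T).1 hT)]
  simp [Set.image_image]

/-! ### Neighbors and walks in the neighbor graph -/

/-- The tile `T` meets its image under the isometry encoded by `(e, x, y)`. -/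
def Meets (A : ℤ) (T : Set Plane) (e x y : ℤ) : Prop :=
  (e = 1 ∨ e = -1) ∧ ∃ v ∈ T, affMap e (y + A * x) x v ∈ T

theorem IsCrystile.exists_digit {A B : ℤ} {T : Set Plane} (hT : IsCrystile A B T) {u : Plane}
    (hu : u ∈ T) : ∃ s i, IsDigit B s i ∧ ∃ p ∈ T, affMap s i 0 p = g A B u := by
  have := Set.mem_image_of_mem (g A B) hu
  rw [hT.set_eq, iUnion_digits] at this
  obtain ⟨⟨p, hp⟩, hx⟩ := Set.mem_iUnion.1 this
  exact ⟨p.1, p.2, hp, hx⟩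

theorem IsCrystile.exists_preimage {A B : ℤ} {T : Set Plane} (hT : IsCrystile A B T) {s i : ℤ}
    (hs : IsDigit B s i) {p : Plane} (hp : p ∈ T) : ∃ u ∈ T, g A B u = affMap s i 0 p := by
  have : affMap s i 0 p ∈ g A B '' T := by
    rw [hT.set_eq, iUnion_digits]
    exact Set.mem_iUnion.2 ⟨⟨(s, i), hs⟩, Set.mem_image_of_mem _ hp⟩
  exact this

theorem Meets.exists_step {A B : ℤ} {T : Set Plane} (hT : IsCrystile A B T) {e x y : ℤ}
    (h : Meets A T e x y) : ∃ e' x' y', Step A B e x y e' x' y' ∧ Meets A T e' x' y' := by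
  obtain ⟨he, v, hv, hu⟩ := h
  obtain ⟨s, i, hs, p, hp, hpu⟩ := hT.exists_digit hu
  obtain ⟨s', j, hs', w, hw, hwv⟩ := hT.exists_digit hv
  have hpu0 := congrArg (fun q : Plane => q 0) hpu
  have hpu1 := congrArg (fun q : Plane => q 1) hpu
  have hwv0 := congrArg (fun q : Plane => q 0) hwv
  have hwv1 := congrArg (fun q : Plane => q 1) hwv
  simp only [g_zero, g_one] at hpu0 hpu1 hwv0 hwv1
  simp [affMap] at hpu0 hpu1 hwv0 hwv1
  -- `k` is the integer `(1 - e) (B - 1) / 2`.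
  obtain ⟨k, hk⟩ : ∃ k, 2 * k = (1 - e) * (B - 1) := by
    rcases he with rfl | rfl
    · exact ⟨0, by ring⟩
    · exact ⟨B - 1, by ring⟩
  have hkR : 2 * (k : ℝ) = (1 - e) * (B - 1) := by exact_mod_cast hk
  refine ⟨s * e * s', s * y, s * (e * j - i + k - A * y - B * x),
    ⟨s, i, s', j, hs, hs', rfl, rfl, ?_⟩, ?_, w, hw, ?_⟩
  · rcases hs with ⟨rfl, -⟩ | ⟨rfl, -⟩ <;> linarith
  · rcases hs with ⟨rfl, -⟩ | ⟨rfl, -⟩ <;> rcases hs' with ⟨rfl, -⟩ | ⟨rfl, -⟩ <;>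
      rcases he with rfl | rfl <;> simp
  · convert hp
    have hv0 : v 0 = s' * w 1 + A * v 1 := by linarith
    ext r; fin_cases r
    · simp [affMap]
      rcases hs with ⟨rfl, -⟩ | ⟨rfl, -⟩ <;> rcases he with rfl | rfl <;>
        push_cast at * <;> nlinarith
    · simp [affMap]
      rcases hs with ⟨rfl, -⟩ | ⟨rfl, -⟩ <;> rcases he with rfl | rfl <;>
        push_cast at * <;> nlinarith

/-- If there is an edge from `γ` to `γ'`, then `u - γ v` is obtained from `p - γ' w` by the inverse
of the linear part of `g`, up to sign. -/
theorem IsCrystile.exists_norm_le {A B : ℤ} {T : Set Plane} (hT : IsCrystile A B T)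
    {L : Plane ≃L[ℝ] Plane} {K : NNReal} (hL : ∀ v, ‖L v‖ ≤ K * ‖L (linMap A B v)‖)
    {e x y e' x' y' : ℤ} (h : Step A B e x y e' x' y') {p w : Plane} (hp : p ∈ T) (hw : w ∈ T) :
    ∃ u ∈ T, ∃ v ∈ T, ‖L (u - affMap e (y + A * x) x v)‖ ≤
      K * ‖L (p - affMap e' (y' + A * x') x' w)‖ := by
  obtain ⟨s, i, s', j, hs, hs', rfl, rfl, hD⟩ := h
  obtain ⟨u, hu, hup⟩ := hT.exists_preimage hs hp
  obtain ⟨v, hv, hvw⟩ := hT.exists_preimage hs' hw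
  refine ⟨u, hu, v, hv, (hL _).trans (le_of_eq ?_)⟩
  have hup0 := congrArg (fun q : Plane => q 0) hup
  have hup1 := congrArg (fun q : Plane => q 1) hup
  have hvw0 := congrArg (fun q : Plane => q 0) hvw
  have hvw1 := congrArg (fun q : Plane => q 1) hvw
  simp only [g_zero, g_one] at hup0 hup1 hvw0 hvw1
  simp [affMap] at hup0 hup1 hvw0 hvw1
  have hDR : 2 * ((s : ℝ) * y' + A * y + B * x) = 2 * (e * j - i) + (1 - e) * (B - 1) := by
    exact_mod_cast hD
  have key : linMap A B (u - affMap e (y + A * x) x v) =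
      (s : ℝ) • (p - affMap (s * e * s') (y' + A * (s * y)) (s * y) w) := by
    have hss : (s : ℝ) * s = 1 := by rcases hs with ⟨rfl, -⟩ | ⟨rfl, -⟩ <;> simp
    ext r; fin_cases r
    · simp [affMap, linMap]
      linear_combination hup0 - e * hvw0 + hDR / 2 + (e * s' * w 0 + A * y) * hss
    · simp [affMap, linMap]
      linear_combination hup1 - e * hvw1 + (e * s' * w 1 + y) * hss
  rw [key, map_smul, norm_smul, Real.norm_eq_abs, hs.abs_eq_one, one_mul]

theorem meets_of_mem_nbrStates {A B : ℤ} (hA : 2 ≤ -A) (hAB : -A ≤ B) (h : 2 * -A < B + 3)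
    {T : Set Plane} (hT : IsCrystile A B T) {e x y : ℤ} (hp : (e, x, y) ∈ nbrStates A B) :
    Meets A T e x y := by
  obtain ⟨L, K, hK, hL⟩ := exists_adapted_norm hA hAB
  obtain ⟨u₀, hu₀⟩ := hT.nonempty
  -- Starting from one point of `T`, walks of length `k` give pairs of points at distance at most
  -- `K ^ k * C`.
  obtain ⟨C, hC⟩ := ((finite_nbrStates A B).image fun p : ℤ × ℤ × ℤ =>
    ‖L (u₀ - affMap p.1 (p.2.2 + A * p.2.1) p.2.1 u₀)‖).bddAbove
  have hk : ∀ (k : ℕ) (e x y : ℤ), (e, x, y) ∈ nbrStates A B → ∃ u ∈ T, ∃ v ∈ T,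
      ‖L (u - affMap e (y + A * x) x v)‖ ≤ K ^ k * C := by
    intro k
    induction k with
    | zero =>
      intro e x y hp
      refine ⟨u₀, hu₀, u₀, hu₀, ?_⟩
      rw [pow_zero, one_mul]
      exact hC ⟨(e, x, y), hp, rfl⟩
    | succ k ih =>
      intro e x y hp
      obtain ⟨e', x', y', hstep, hp'⟩ := exists_step_of_mem_nbrStates hA hAB h hp
      obtain ⟨p, hp, w, hw, hpw⟩ := ih _ _ _ hp'
      obtain ⟨u, hu, v, hv, huv⟩ := hT.exists_norm_le hL hstep hp hw
      refine ⟨u, hu, v, hv, huv.trans ?_⟩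
      rw [pow_succ', mul_assoc]
      gcongr
  have hcont : Continuous fun q : Plane × Plane => ‖L (q.1 - affMap e (y + A * x) x q.2)‖ := by
    unfold affMap
    fun_prop
  obtain ⟨⟨u, v⟩, ⟨hu, hv⟩, hmin⟩ := (hT.isCompact.prod hT.isCompact).exists_isMinOn
    (hT.nonempty.prod hT.nonempty) hcont.continuousOn
  have hle : ∀ k : ℕ, ‖L (u - affMap e (y + A * x) x v)‖ ≤ K ^ k * C := by
    intro k
    obtain ⟨u', hu', v', hv', h'⟩ := hk k e x y hp
    exact (hmin (Set.mk_mem_prod hu' hv')).trans h'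
  have hlim : Filter.Tendsto (fun k : ℕ => (K : ℝ) ^ k * C) Filter.atTop (nhds 0) := by
    simpa using (tendsto_pow_atTop_nhds_zero_of_lt_one K.2 (by exact_mod_cast hK)).mul_const C
  have h0 : ‖L (u - affMap e (y + A * x) x v)‖ ≤ 0 := ge_of_tendsto' hlim hle
  have h1 : u = affMap e (y + A * x) x v := by
    rw [norm_le_zero_iff, map_eq_zero_iff _ L.injective, sub_eq_zero] at h0
    exact h0
  refine ⟨?_, v, hv, h1 ▸ hu⟩
  simp only [nbrStates, Set.mem_ofPred_eq, Prod.mk.injEq] at hp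
  omega

/-- The states of the isometries under which the image of the tile meets the tile. -/
theorem meets_iff {A B : ℤ} (hA : 2 ≤ -A) (hAB : -A ≤ B) (h : 2 * -A < B + 3)
    {T : Set Plane} (hT : IsCrystile A B T) {e x y : ℤ} :
    Meets A T e x y ↔ (e, x, y) ∈ nbrStates A B := by
  refine ⟨?_, meets_of_mem_nbrStates hA hAB h hT⟩
  obtain ⟨C, hC⟩ := hT.isCompact.isBounded.exists_norm_le
  refine mem_nbrStates_of_invariant hA hAB h (Meets A T) ⌈2 * C⌉ ?_
    (fun _ _ _ h => h.exists_step hT) e x y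
  rintro e x y ⟨he, v, hv, hu⟩
  refine ⟨he, ?_⟩
  have h1 := (PiLp.norm_apply_le v 1).trans (hC v hv)
  have h2 := (PiLp.norm_apply_le _ 1).trans (hC _ hu)
  have h3 : (|x| : ℤ) ≤ 2 * C := by
    simp [affMap] at h1 h2
    rw [abs_le] at h1 h2
    push_cast
    rw [abs_le]
    rcases he with rfl | rfl <;> push_cast at h2 <;> constructor <;> linarith
  exact_mod_cast h3.trans (Int.le_ceil _)

/-! ### The neighbor set -/

/-- The isometry `v ↦ e • v + (y + A * x, x)` as an element of `p2`, for `e = 1` or `e = -1`. -/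
noncomputable def stateIso (A : ℤ) (p : ℤ × ℤ × ℤ) : Plane ≃ᵢ Plane :=
  a ^ (p.2.2 + A * p.2.1) * b ^ p.2.1 * if p.1 = 1 then 1 else c

theorem coe_stateIso (A : ℤ) {e : ℤ} (he : e = 1 ∨ e = -1) (x y : ℤ) :
    ⇑(stateIso A (e, x, y)) = affMap e (y + A * x) x := by
  funext v
  simp only [stateIso, IsometryEquiv.mul_apply, a_zpow_apply, b_zpow_apply]
  rcases he with rfl | rfl <;> ext k <;> fin_cases k <;> simp [affMap, c_apply]

theorem affMap_injective {e e' m m' n n' : ℤ} (h : affMap e m n = affMap e' m' n') :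
    e = e' ∧ m = m' ∧ n = n' := by
  have h0 := congrFun h 0
  have h1 := congrFun h !₂[1, 0]
  have h00 := congrArg (fun q : Plane => q 0) h0
  have h01 := congrArg (fun q : Plane => q 1) h0
  have h10 := congrArg (fun q : Plane => q 0) h1
  simp [affMap] at h00 h01 h10
  subst h00
  exact ⟨by simpa using h10, rfl, h01⟩

theorem stateIso_injOn (A : ℤ) : Set.InjOn (stateIso A) {p | p.1 = 1 ∨ p.1 = -1} := by
  rintro ⟨e, x, y⟩ he ⟨e', x', y'⟩ he' h
  have h' := congrArg (fun γ : Plane ≃ᵢ Plane => ⇑γ) h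
  simp only [coe_stateIso A he, coe_stateIso A he'] at h'
  obtain ⟨rfl, h2, rfl⟩ := affMap_injective h'
  simpa using h2

theorem stateIso_mem_p2 (A : ℤ) (p : ℤ × ℤ × ℤ) : stateIso A p ∈ p2 := by
  have ha : a ∈ p2 := Subgroup.subset_closure (by simp)
  have hb : b ∈ p2 := Subgroup.subset_closure (by simp)
  have hc : c ∈ p2 := Subgroup.subset_closure (by simp)
  refine mul_mem (mul_mem (zpow_mem ha _) (zpow_mem hb _)) ?_
  split_ifs
  exacts [one_mem _, hc]

theorem exists_stateIso_eq (A : ℤ) {γ : Plane ≃ᵢ Plane} (hγ : γ ∈ p2) :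
    ∃ e x y, (e = 1 ∨ e = -1) ∧ γ = stateIso A (e, x, y) := by
  suffices h : ∃ e m n : ℤ, (e = 1 ∨ e = -1) ∧ ⇑γ = affMap e m n by
    obtain ⟨e, m, n, he, h⟩ := h
    refine ⟨e, n, m - A * n, he, DFunLike.coe_injective ?_⟩
    rw [h, coe_stateIso A he, sub_add_cancel]
  induction hγ using Subgroup.closure_induction with
  | mem γ h =>
    rcases h with rfl | rfl | rfl
    · refine ⟨1, 1, 0, Or.inl rfl, ?_⟩
      funext v; ext k; fin_cases k <;> simp [affMap, a]
    · refine ⟨1, 0, 1, Or.inl rfl, ?_⟩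
      funext v; ext k; fin_cases k <;> simp [affMap, b]
    · refine ⟨-1, 0, 0, Or.inr rfl, ?_⟩
      funext v; ext k; fin_cases k <;> simp [affMap, c]
  | one =>
    refine ⟨1, 0, 0, Or.inl rfl, ?_⟩
    funext v; ext k; fin_cases k <;> simp [affMap]
  | mul γ γ' _ _ h h' =>
    obtain ⟨e, m, n, he, h⟩ := h
    obtain ⟨e', m', n', he', h'⟩ := h'
    refine ⟨e * e', e * m' + m, e * n' + n, ?_, ?_⟩
    · rcases he with rfl | rfl <;> rcases he' with rfl | rfl <;> simp
    · funext v
      rw [IsometryEquiv.mul_apply, h, h']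
      ext k; fin_cases k <;> simp [affMap] <;> ring
  | inv γ _ h =>
    obtain ⟨e, m, n, he, h⟩ := h
    refine ⟨e, -e * m, -e * n, he, ?_⟩
    funext v
    change γ.symm v = _
    rw [IsometryEquiv.symm_apply_eq, h]
    rcases he with rfl | rfl <;> ext k <;> fin_cases k <;> simp [affMap]

theorem fst_of_mem_nbrStates {A B : ℤ} {p : ℤ × ℤ × ℤ} (hp : p ∈ nbrStates A B) :
    p.1 = 1 ∨ p.1 = -1 := by
  obtain ⟨e, x, y⟩ := p
  simp only [nbrStates, Set.mem_ofPred_eq, Prod.mk.injEq] at hp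
  omega

theorem neighborSet_eq_image {A B : ℤ} (hA : 2 ≤ -A) (hAB : -A ≤ B) (h : 2 * -A < B + 3)
    {T : Set Plane} (hT : IsCrystile A B T) :
    neighborSet T = stateIso A '' (nbrStates A B \ {(1, 0, 0)}) := by
  have h1 : stateIso A (1, 0, 0) = 1 := by simp [stateIso]
  have hmeet : ∀ e x y, (e = 1 ∨ e = -1) →
      ((stateIso A (e, x, y) '' T ∩ T).Nonempty ↔ (e, x, y) ∈ nbrStates A B) := by
    intro e x y he
    rw [← meets_iff hA hAB h hT, coe_stateIso A he]
    constructor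
    · rintro ⟨_, ⟨v, hv, rfl⟩, hu⟩
      exact ⟨he, v, hv, hu⟩
    · rintro ⟨-, v, hv, hu⟩
      exact ⟨_, ⟨v, hv, rfl⟩, hu⟩
  ext γ
  constructor
  · rintro ⟨hγ, hne, hmt⟩
    obtain ⟨e, x, y, he, rfl⟩ := exists_stateIso_eq A hγ
    refine ⟨(e, x, y), ⟨(hmeet e x y he).1 hmt, ?_⟩, rfl⟩
    rintro (heq : (e, x, y) = _)
    exact hne (by rw [heq, h1])
  · rintro ⟨⟨e, x, y⟩, ⟨hp, hne⟩, rfl⟩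
    have he := fst_of_mem_nbrStates hp
    refine ⟨stateIso_mem_p2 _ _, fun heq => hne ?_, (hmeet e x y he).2 hp⟩
    exact stateIso_injOn A he (Or.inl rfl) (heq.trans h1.symm)

theorem neighborSet_eq_and_ncard {A B : ℤ} (hA : 2 ≤ -A) (hAB : -A ≤ B) (h : 2 * -A < B + 3)
    {T : Set Plane} (hT : IsCrystile A B T) (F : Finset (ℤ × ℤ × ℤ))
    (hF : ∀ p ∈ nbrStates A B, p ≠ (1, 0, 0) → p ∈ F)
    (hF' : ∀ p ∈ F, p ∈ nbrStates A B ∧ p ≠ (1, 0, 0)) {N : Set (Plane ≃ᵢ Plane)}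
    (hN : stateIso A '' F = N) :
    neighborSet T = N ∧ (neighborSet T).ncard = F.card := by
  have hinj : Set.InjOn (stateIso A) F :=
    (stateIso_injOn A).mono fun p hp => fst_of_mem_nbrStates (hF' p hp).1
  have hFeq : nbrStates A B \ {(1, 0, 0)} = F :=
    Set.Subset.antisymm (fun p hp => hF p hp.1 hp.2) hF'
  rw [neighborSet_eq_image hA hAB h hT, hFeq, hinj.ncard_image, Set.ncard_coe_finset]
  exact ⟨hN, rfl⟩

end P2Tile

set_option maxHeartbeats 800000 in
theorem mainTheorem3 (A B : ℤ) (hA : 2 ≤ -A) (hAB : -A ≤ B) (h : 2 * |A| < B + 3) :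
    (∃! T : Set Plane, IsCrystile A B T) ∧
    ∀ T : Set Plane, IsCrystile A B T →
      (A = -2 → B = 2 →
        neighborSet T =
          {a⁻¹ * b, a * b⁻¹, c, a⁻¹ * c, a ^ (-2 : ℤ) * b * c, a⁻¹ * b * c} ∧
        (neighborSet T).ncard = 6) ∧
      (A = -2 → B = 3 →
        neighborSet T = {a, a⁻¹, c, a⁻¹ * c, a ^ (-2 : ℤ) * b * c, a⁻¹ * b * c} ∧
        (neighborSet T).ncard = 6) ∧
      (A = -2 → 4 ≤ B →
        neighborSet T = {a, a⁻¹, c, a * c, a ^ (-2 : ℤ) * b * c, a⁻¹ * b * c} ∧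
        (neighborSet T).ncard = 6) ∧
      (A = -3 → B = 4 →
        neighborSet T =
          {a, a⁻¹, a ^ (-2 : ℤ) * b, a ^ (2 : ℤ) * b⁻¹, c, a⁻¹ * c,
            a ^ (-2 : ℤ) * b * c, a ^ (-3 : ℤ) * b * c} ∧
        (neighborSet T).ncard = 8) ∧
      (A = -3 → 5 ≤ B →
        neighborSet T =
          {a, a⁻¹, a ^ (A + 1) * b, a ^ (-1 - A) * b⁻¹, c, a * c,
            a ^ (A + 1) * b * c, a ^ A * b * c, a⁻¹ * c} ∧
        (neighborSet T).ncard = 9) ∧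
      (A ≤ -4 → 6 ≤ B →
        neighborSet T =
          {a, a⁻¹, a ^ (A + 1) * b, a ^ (-1 - A) * b⁻¹, c, a⁻¹ * c, a * c,
            a ^ (A + 1) * b * c, a ^ A * b * c, a ^ (-A - 1) * b⁻¹ * c} ∧
        (neighborSet T).ncard = 10) := by
  rw [abs_of_nonpos (by omega)] at h
  refine ⟨existsUnique_isCrystile hA hAB, fun T hT => ⟨?_, ?_, ?_, ?_, ?_, ?_⟩⟩
  · rintro rfl rfl
    refine neighborSet_eq_and_ncard hA hAB h hT {(1, 1, 1), (1, -1, -1), (-1, 0, 0), (-1, 0, -1),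
      (-1, 1, 0), (-1, 1, 1)} ?_ ?_ ?_
    · rintro _ (rfl | rfl | rfl | rfl | ⟨hc, rfl | rfl⟩ | ⟨hc, rfl | rfl⟩ | ⟨hc, rfl⟩ | ⟨hc, rfl⟩ |
        ⟨hc, rfl⟩) hne <;> first | exact absurd rfl hne | (simp; done) | (exfalso; omega)
    · simp [nbrStates]
    · simp [Set.image_insert_eq, stateIso]
  · rintro rfl rfl
    refine neighborSet_eq_and_ncard hA hAB h hT {(1, 0, 1), (1, 0, -1), (-1, 0, 0), (-1, 0, -1),
      (-1, 1, 0), (-1, 1, 1)} ?_ ?_ ?_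
    · rintro _ (rfl | rfl | rfl | rfl | ⟨hc, rfl | rfl⟩ | ⟨hc, rfl | rfl⟩ | ⟨hc, rfl⟩ | ⟨hc, rfl⟩ |
        ⟨hc, rfl⟩) hne <;> first | exact absurd rfl hne | (simp; done) | (exfalso; omega)
    · simp [nbrStates]
    · simp [Set.image_insert_eq, stateIso]
  · rintro rfl hB
    refine neighborSet_eq_and_ncard hA hAB h hT {(1, 0, 1), (1, 0, -1), (-1, 0, 0), (-1, 0, 1),
      (-1, 1, 0), (-1, 1, 1)} ?_ ?_ ?_
    · rintro _ (rfl | rfl | rfl | rfl | ⟨hc, rfl | rfl⟩ | ⟨hc, rfl | rfl⟩ | ⟨hc, rfl⟩ | ⟨hc, rfl⟩ |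
        ⟨hc, rfl⟩) hne <;> first | exact absurd rfl hne | (simp; done) | (exfalso; omega)
    · simp [nbrStates]
      omega
    · simp [Set.image_insert_eq, stateIso]
  · rintro rfl rfl
    refine neighborSet_eq_and_ncard hA hAB h hT {(1, 0, 1), (1, 0, -1), (1, 1, 1), (1, -1, -1),
      (-1, 0, 0), (-1, 0, -1), (-1, 1, 1), (-1, 1, 0)} ?_ ?_ ?_
    · rintro _ (rfl | rfl | rfl | rfl | ⟨hc, rfl | rfl⟩ | ⟨hc, rfl | rfl⟩ | ⟨hc, rfl⟩ | ⟨hc, rfl⟩ |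
        ⟨hc, rfl⟩) hne <;> first | exact absurd rfl hne | (simp; done) | (exfalso; omega)
    · simp [nbrStates]
    · simp [Set.image_insert_eq, stateIso]
  · intro hA3 hB
    refine neighborSet_eq_and_ncard hA hAB h hT {(1, 0, 1), (1, 0, -1), (1, 1, 1), (1, -1, -1),
      (-1, 0, 0), (-1, 0, 1), (-1, 1, 1), (-1, 1, 0), (-1, 0, -1)} ?_ ?_ ?_
    · rintro _ (rfl | rfl | rfl | rfl | ⟨hc, rfl | rfl⟩ | ⟨hc, rfl | rfl⟩ | ⟨hc, rfl⟩ | ⟨hc, rfl⟩ |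
        ⟨hc, rfl⟩) hne <;> first | exact absurd rfl hne | (simp; done) | (exfalso; omega)
    · simp [nbrStates]
      omega
    · simp [Set.image_insert_eq, stateIso, add_comm, sub_eq_add_neg]
  · intro hA4 hB
    refine neighborSet_eq_and_ncard hA hAB h hT {(1, 0, 1), (1, 0, -1), (1, 1, 1), (1, -1, -1),
      (-1, 0, 0), (-1, 0, -1), (-1, 0, 1), (-1, 1, 1), (-1, 1, 0), (-1, -1, -1)} ?_ ?_ ?_
    · rintro _ (rfl | rfl | rfl | rfl | ⟨hc, rfl | rfl⟩ | ⟨hc, rfl | rfl⟩ | ⟨hc, rfl⟩ | ⟨hc, rfl⟩ |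
        ⟨hc, rfl⟩) hne <;> first | exact absurd rfl hne | simp
    · simp [nbrStates]
      omega
    · simp [Set.image_insert_eq, stateIso, add_comm, sub_eq_add_neg]
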